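/- Theorem 2.3. Let $p\ge 1$ and let $a_n>0$, $b_n\in\mathbb{R}$ ($n\ge 1$) be Jacobi parameters of period $p$: $a_{n+p}=a_n$, $b_{n+p}=b_n$ for all $n\ge1$. Let $p_n$ be the associated orthonormal polynomials, given by $p_{-1}=0$, $p_0=1$ and $$x\,p_n(x)=a_{n+1}p_{n+1}(x)+b_{n+1}p_n(x)+a_np_{n-1}(x)\qquad(n\ge 0),$$ and let $P_n=a_1\cdots a_n\,p_n$ be the monic orthogonal polynomials. Put $a_0=a_p$, $$A_k(z)=\frac1{a_{k+1}}\begin{pmatrix} z-b_{k+1} & -a_k\\ a_{k+1}&0\end{pmatrix},\qquad T_p(z)=A_{p-1}(z)\cdots A_0(z),\qquad \Delta(z)=\operatorname{Tr}T_p(z),$$ and let $\alpha_1<\beta_1\le\alpha_2<\beta_2\le\cdots\le\alpha_p<\beta_p$ be the $2p$ solutions, all real, of $\Delta=2$ and of $\Delta=-2$, listed in increasing order and repeated according to multiplicity. For $1\le j\le p$ and $n\ge 0$ let $N^{(n,j)}$ be the number of zeros of $P_n$ in the open band $(\alpha_j,\beta_j)$. Then for all integers $m\ge 0$ and $-1\le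 b\le p-1$ with $mp+b\ge 0$, $$\bigl|N^{(mp+b,j)}-(m-1)\bigr|\le\min(b+1,\;p-b).$$ In particular, for all $n\ge 0$, $$\Bigl|N^{(n,j)}-\frac np\Bigr|\le 1+\frac p2 .$$ -/

import Mathlib

open Polynomial

noncomputable section

namespace PeriodicJacobi

/-- The orthonormal polynomials `p_n` on the real line with Jacobi parameters `a_1, a_2, …` and
`b_1, b_2, …` (the values `a 0` and `b 0` are never used): `p_{-1} = 0`, `p_0 = 1` and
`x p_n = a_{n+1} p_{n+1} + b_{n+1} p_n + a_n p_{n-1}`. -/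
def orthonormalPoly (a b : ℕ → ℝ) : ℕ → ℝ[X]
  | 0 => 1
  | 1 => C (a 1)⁻¹ * (X - C (b 1))
  | n + 2 => C (a (n + 2))⁻¹ *
      ((X - C (b (n + 2))) * orthonormalPoly a b (n + 1) - C (a (n + 1)) * orthonormalPoly a b n)

/-- The monic orthogonal polynomials `P_n = a_1 ⋯ a_n p_n`. -/
def monicPoly (a b : ℕ → ℝ) (n : ℕ) : ℝ[X] :=
  C (∏ k ∈ Finset.Icc 1 n, a k) * orthonormalPoly a b n

/-- The off-diagonal parameters `a_0, a_1, a_2, …` with the convention `a_0 = a_p`. -/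
def extA (p : ℕ) (a : ℕ → ℝ) (k : ℕ) : ℝ := if k = 0 then a p else a k

/-- The one-step matrix `A_k(z)`, with entries polynomial in `z`. -/
def stepMatrix (p : ℕ) (a b : ℕ → ℝ) (k : ℕ) : Matrix (Fin 2) (Fin 2) ℝ[X] :=
  C (a (k + 1))⁻¹ • !![X - C (b (k + 1)), -C (extA p a k); C (a (k + 1)), 0]

/-- The transfer matrix `T_n(z) = A_{n-1}(z) ⋯ A_0(z)`. -/
def transferMatrix (p : ℕ) (a b : ℕ → ℝ) : ℕ → Matrix (Fin 2) (Fin 2) ℝ[X]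
  | 0 => 1
  | n + 1 => stepMatrix p a b n * transferMatrix p a b n

/-- The discriminant `Δ(z) = Tr T_p(z)`. -/
def discriminant (p : ℕ) (a b : ℕ → ℝ) : ℝ[X] := (transferMatrix p a b p).trace

/-- All solutions of `Δ = 2` and of `Δ = -2`, listed in increasing order and repeated according
to multiplicity. For periodic Jacobi parameters these are `2p` real numbers
`α_1 < β_1 ≤ α_2 < β_2 ≤ ⋯ < β_p`. -/
def bandEdges (p : ℕ) (a b : ℕ → ℝ) : List ℝ :=
  ((discriminant p a b - C 2).roots + (discriminant p a b + C 2).roots).sort (· ≤ ·)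

/-- The left end of the `j`-th band, where `j = 0, …, p - 1`. -/
def bandLeft (p : ℕ) (a b : ℕ → ℝ) (j : Fin p) : ℝ := (bandEdges p a b).getD (2 * j) 0

/-- The right end of the `j`-th band, where `j = 0, …, p - 1`. -/
def bandRight (p : ℕ) (a b : ℕ → ℝ) (j : Fin p) : ℝ := (bandEdges p a b).getD (2 * j + 1) 0

/-- The number of zeros of `P_n` in the open `j`-th band. -/
def numZeros (p : ℕ) (a b : ℕ → ℝ) (n : ℕ) (j : Fin p) : ℕ :=
  {x : ℝ | x ∈ Set.Ioo (bandLeft p a b j) (bandRight p a b j) ∧ (monicPoly a b n).IsRoot x}.ncard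

end PeriodicJacobi

end

/-!
Write `Δ` for the discriminant and `N n` for the number of zeros of `P_n` in a fixed band `(α, β)`.
Consecutive orthogonal polynomials have a Wronskian without zeros
(`wronskian_orthonormalPoly_pos`), so by Rolle's theorem for their quotient their zeros interlace and
`N` changes by at most one from `n` to `n + 1`. It is therefore enough to know `N` exactly along an
arithmetic progression of step `p`: `N ((m + 1) p - 1) = m` (`numZeros_period`). A degree
`n = mp + r` lies `r + 1` steps after `mp - 1` and `p - 1 - r` steps before `(m + 1)p - 1`, which
gives both bounds of the theorem.

The exact count rests on the factorization `p_{(m+1)p-1} = U_m(Δ/2) p_{p-1}`, an entry of the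
Cayley–Hamilton formula for powers of the transfer matrix over a period
(`orthonormalPoly_eval_period`). The factor `p_{p-1}` has no zeros where `|Δ| < 2`, the Chebyshev
polynomial `U_m(v/2)` has `m` zeros `v ∈ (-2, 2)`, and `Δ` maps each band bijectively onto `(-2, 2)`
(`bijOn_discriminant_band`).

The band structure is derived from one fact: `Δ - v` is real-rooted for every `v ∈ [-2, 2]`
(`splits_discriminant_sub_C`). Indeed `Δ(z) = v` yields a Floquet solution with a multiplier of
modulus one, and the conservation of its Wronskian forces `Im z = 0`. Laguerre's inequality,
applied to `Δ - v` for varying `v`, then excludes critical points where `|Δ| < 2`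
(`eval_derivative_discriminant_ne_zero`). Hence `Δ` has `p` simple real zeros, any two of which are
separated by a band edge. By the sign of `Δ² - 4`, each has an odd number of edges to its left, so
by pigeonhole the `j`-th zero lies between the edges number `2j` and `2j + 1`, counted from `0`
(`exists_zero_countP_bandEdges`).
-/

namespace PeriodicJacobi

/-! ### Real polynomials -/

theorem eval_mul_eval_derivative_derivative_le_prod (s : Multiset ℝ) (x : ℝ) :
    ((s.map fun r => X - C r).prod).eval x *
        (derivative (derivative (s.map fun r => X - C r).prod)).eval x ≤
      (derivative (s.map fun r => X - C r).prod).eval x ^ 2 := by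
  induction s using Multiset.induction with
  | empty => simp
  | cons r t ih =>
    simp only [Multiset.map_cons, Multiset.prod_cons, derivative_mul, derivative_sub,
      derivative_X, derivative_C, sub_zero, one_mul, eval_add, eval_mul, eval_sub, eval_X, eval_C,
      derivative_add]
    nlinarith [mul_le_mul_of_nonneg_left ih (sq_nonneg (x - r)),
      sq_nonneg (((t.map fun r => X - C r).prod).eval x)]

/-- Laguerre's inequality: the logarithmic derivative of a real-rooted polynomial is strictly
decreasing. -/
theorem eval_mul_eval_derivative_derivative_lt {f : ℝ[X]} (hf : f.Splits) (hd : f.natDegree ≠ 0)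
    {x : ℝ} (hx : f.eval x ≠ 0) :
    f.eval x * (derivative (derivative f)).eval x < (derivative f).eval x ^ 2 := by
  obtain ⟨r, hr⟩ := Multiset.exists_mem_of_ne_zero (hf.roots_ne_zero hd)
  obtain ⟨t, ht⟩ := Multiset.exists_cons_of_mem hr
  have h := hf.eq_prod_roots
  rw [ht, Multiset.map_cons, Multiset.prod_cons] at h
  have ih := eval_mul_eval_derivative_derivative_le_prod t x
  set c := f.leadingCoeff
  set g := (t.map fun r => X - C r).prod
  rw [h] at hx ⊢
  simp only [eval_mul, eval_C, eval_sub, eval_X] at hx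
  have hc : 0 < c ^ 2 := by positivity [left_ne_zero_of_mul hx]
  have hg : 0 < g.eval x ^ 2 := by
    have := right_ne_zero_of_mul (right_ne_zero_of_mul hx)
    positivity
  simp only [derivative_mul, derivative_sub,
    derivative_X, derivative_C, sub_zero, one_mul, eval_add, eval_mul, eval_sub, eval_X, eval_C,
    derivative_add, zero_mul, zero_add]
  have h1 := mul_le_mul_of_nonneg_left ih (sq_nonneg (x - r))
  have h2 : 0 < c ^ 2 * (g.eval x ^ 2 + ((x - r) ^ 2 * (derivative g).eval x ^ 2 -
      (x - r) ^ 2 * (g.eval x * (derivative (derivative g)).eval x))) :=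
    mul_pos hc (by linarith)
  linear_combination h2

/-- A family of real-rooted translates `f - v`, `v ∈ [-2, 2]`, has no critical value in `(-2, 2)`:
otherwise Laguerre's inequality for the two translates `f - (v ± ε)` would force the second
derivative to have both signs. -/
theorem eval_derivative_ne_zero_of_splits {f : ℝ[X]} (hd : f.natDegree ≠ 0)
    (hf : ∀ v ∈ Set.Icc (-2 : ℝ) 2, (f - C v).Splits) {x : ℝ} (hx : |f.eval x| < 2) :
    (derivative f).eval x ≠ 0 := by
  intro h0
  rw [abs_lt] at hx
  have key : ∀ w ∈ Set.Icc (-2 : ℝ) 2, f.eval x ≠ w →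
      (f.eval x - w) * (derivative (derivative f)).eval x < 0 := by
    intro w hw hne
    have := eval_mul_eval_derivative_derivative_lt (hf w hw) (by rwa [natDegree_sub_C])
      (x := x) (by simpa [sub_eq_zero] using hne)
    simpa [h0] using this
  have h1 := key ((f.eval x + 2) / 2) ⟨by linarith, by linarith⟩ (by linarith)
  have h2 := key ((f.eval x - 2) / 2) ⟨by linarith, by linarith⟩ (by linarith)
  nlinarith

theorem finite_isRoot_Ioo {f : ℝ[X]} (hf : f ≠ 0) (u v : ℝ) :
    {x : ℝ | x ∈ Set.Ioo u v ∧ f.IsRoot x}.Finite :=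
  (finite_setOfPred_isRoot hf).subset fun _ hx => hx.2

/-- If the Wronskian of `f` and `g` has no zeros, the zeros of `f` and `g` interlace, by Rolle's
theorem for `f / g`. -/
theorem exists_isRoot_between {f g : ℝ[X]}
    (hW : ∀ x, (derivative f).eval x * g.eval x - f.eval x * (derivative g).eval x ≠ 0)
    {x y : ℝ} (hxy : x < y) (hx : f.IsRoot x) (hy : f.IsRoot y) :
    ∃ z ∈ Set.Ioo x y, g.IsRoot z := by
  by_contra! hno
  have hg : ∀ z ∈ Set.Icc x y, g.eval z ≠ 0 := by
    intro z hz h0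
    rcases eq_or_lt_of_le hz.1 with rfl | h1
    · exact hW x (by simp [h0, hx.eq_zero])
    rcases eq_or_lt_of_le hz.2 with rfl | h2
    · exact hW z (by simp [h0, hy.eq_zero])
    exact hno z ⟨h1, h2⟩ h0
  obtain ⟨z, hz, h⟩ := exists_hasDerivAt_eq_zero (f := fun t => f.eval t / g.eval t)
    (f' := fun t => ((derivative f).eval t * g.eval t - f.eval t * (derivative g).eval t) /
      g.eval t ^ 2) hxy
    (f.continuous.continuousOn.div g.continuous.continuousOn hg)
    (by simp [hx.eq_zero, hy.eq_zero])
    (fun t ht => (f.hasDerivAt t).div (g.hasDerivAt t) (hg t ⟨ht.1.le, ht.2.le⟩))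
  rcases div_eq_zero_iff.1 h with h | h
  · exact hW z h
  · exact hg z ⟨hz.1.le, hz.2.le⟩ (pow_eq_zero_iff two_ne_zero |>.1 h)

theorem ncard_isRoot_Ioo_le_succ {f g : ℝ[X]} (hf : f ≠ 0) (hg : g ≠ 0)
    (hW : ∀ x, (derivative f).eval x * g.eval x - f.eval x * (derivative g).eval x ≠ 0)
    (u v : ℝ) :
    {x : ℝ | x ∈ Set.Ioo u v ∧ f.IsRoot x}.ncard ≤
      {x : ℝ | x ∈ Set.Ioo u v ∧ g.IsRoot x}.ncard + 1 := by
  rw [Set.ncard_eq_toFinset_card _ (finite_isRoot_Ioo hf u v),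
    Set.ncard_eq_toFinset_card _ (finite_isRoot_Ioo hg u v)]
  refine Finset.card_le_of_interleaved fun x hx y hy hxy _ => ?_
  simp only [Set.Finite.mem_toFinset, Set.mem_ofPred_eq] at hx hy ⊢
  obtain ⟨z, hz, h⟩ := exists_isRoot_between hW hxy hx.2 hy.2
  exact ⟨z, ⟨⟨hx.1.1.trans hz.1, hz.2.trans hy.1.2⟩, h⟩, hz.1, hz.2⟩

/-! ### Orthogonal polynomials -/

theorem orthonormalPoly_succ_succ {a : ℕ → ℝ} (b : ℕ → ℝ) {n : ℕ} (ha : a (n + 2) ≠ 0) :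
    C (a (n + 2)) * orthonormalPoly a b (n + 2) =
      (X - C (b (n + 2))) * orthonormalPoly a b (n + 1) - C (a (n + 1)) * orthonormalPoly a b n := by
  rw [orthonormalPoly, ← mul_assoc, ← C_mul, mul_inv_cancel₀ ha, C_1, one_mul]

/-- Positivity in the confluent Christoffel–Darboux formula. -/
theorem wronskian_orthonormalPoly_pos {a : ℕ → ℝ} (b : ℕ → ℝ) (ha : ∀ n, 1 ≤ n → 0 < a n)
    (n : ℕ) (x : ℝ) :
    0 < a (n + 1) * ((derivative (orthonormalPoly a b (n + 1))).eval x *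
        (orthonormalPoly a b n).eval x -
      (orthonormalPoly a b (n + 1)).eval x * (derivative (orthonormalPoly a b n)).eval x) := by
  induction n with
  | zero =>
    have := ha 1 le_rfl
    simp [orthonormalPoly, this.ne']
  | succ n ih =>
    have h := orthonormalPoly_succ_succ b (ha (n + 2) (by omega)).ne'
    have h' := congrArg (fun f => (derivative f).eval x) h
    have h := congrArg (fun f => f.eval x) h
    simp only [eval_mul, eval_sub, derivative_mul, derivative_sub, derivative_X, derivative_C,
      eval_C, eval_X, eval_add, sub_zero, one_mul, zero_mul, zero_add] at h h'
    have := sq_nonneg ((orthonormalPoly a b (n + 1)).eval x)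
    simp only [show n + 1 + 1 = n + 2 from rfl]
    linear_combination ih + this + h * (derivative (orthonormalPoly a b (n + 1))).eval x -
      h' * (orthonormalPoly a b (n + 1)).eval x

theorem orthonormalPoly_ne_zero {a : ℕ → ℝ} (b : ℕ → ℝ) (ha : ∀ n, 1 ≤ n → 0 < a n) (n : ℕ) :
    orthonormalPoly a b n ≠ 0 := by
  intro h
  simpa [h] using wronskian_orthonormalPoly_pos b ha n 0

theorem natDegree_orthonormalPoly_le (a b : ℕ → ℝ) (n : ℕ) :
    (orthonormalPoly a b n).natDegree ≤ n := by
  induction n using Nat.twoStepInduction with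
  | zero => simp [orthonormalPoly]
  | one => exact (natDegree_C_mul_le _ _).trans (by simp)
  | more n h1 h2 =>
    refine (natDegree_C_mul_le _ _).trans ((natDegree_sub_le _ _).trans (max_le ?_ ?_))
    · refine natDegree_mul_le.trans ?_
      rw [natDegree_X_sub_C]
      omega
    · exact (natDegree_C_mul_le _ _).trans (by omega)

theorem isRoot_monicPoly {a : ℕ → ℝ} (b : ℕ → ℝ) (ha : ∀ n, 1 ≤ n → 0 < a n) (n : ℕ) (x : ℝ) :
    (monicPoly a b n).IsRoot x ↔ (orthonormalPoly a b n).IsRoot x := by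
  have : ∏ k ∈ Finset.Icc 1 n, a k ≠ 0 :=
    Finset.prod_ne_zero_iff.2 fun k hk => (ha k (Finset.mem_Icc.1 hk).1).ne'
  simp only [monicPoly, IsRoot, eval_mul, eval_C, mul_eq_zero, this, false_or]

theorem numZeros_eq (p : ℕ) {a : ℕ → ℝ} (b : ℕ → ℝ) (ha : ∀ n, 1 ≤ n → 0 < a n) (n : ℕ)
    (j : Fin p) :
    numZeros p a b n j = {x : ℝ | x ∈ Set.Ioo (bandLeft p a b j) (bandRight p a b j) ∧
      (orthonormalPoly a b n).IsRoot x}.ncard := by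
  simp only [numZeros, isRoot_monicPoly b ha]

theorem numZeros_le (p : ℕ) {a : ℕ → ℝ} (b : ℕ → ℝ) (ha : ∀ n, 1 ≤ n → 0 < a n) (n : ℕ)
    (j : Fin p) : numZeros p a b n j ≤ n := by
  rw [numZeros_eq p b ha]
  have h0 := orthonormalPoly_ne_zero b ha n
  refine le_trans ?_ ((card_roots' _).trans (natDegree_orthonormalPoly_le a b n))
  refine le_trans ?_ (Multiset.toFinset_card_le _)
  rw [← Set.ncard_coe_finset]
  exact Set.ncard_le_ncard (fun x hx => by simpa [h0] using hx.2) (Finset.finite_toSet _)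

theorem abs_numZeros_succ_sub_le (p : ℕ) {a : ℕ → ℝ} (b : ℕ → ℝ) (ha : ∀ n, 1 ≤ n → 0 < a n)
    (n : ℕ) (j : Fin p) : |(numZeros p a b (n + 1) j : ℤ) - numZeros p a b n j| ≤ 1 := by
  have hW : ∀ x, (derivative (orthonormalPoly a b (n + 1))).eval x *
        (orthonormalPoly a b n).eval x -
      (orthonormalPoly a b (n + 1)).eval x * (derivative (orthonormalPoly a b n)).eval x ≠ 0 :=
    fun x => right_ne_zero_of_mul (wronskian_orthonormalPoly_pos b ha n x).ne'
  have hn := orthonormalPoly_ne_zero b ha n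
  have hn1 := orthonormalPoly_ne_zero b ha (n + 1)
  have h1 := ncard_isRoot_Ioo_le_succ hn1 hn hW (bandLeft p a b j) (bandRight p a b j)
  have h2 := ncard_isRoot_Ioo_le_succ hn hn1
    (fun x h => hW x (by linear_combination -h)) (bandLeft p a b j) (bandRight p a b j)
  rw [← numZeros_eq p b ha, ← numZeros_eq p b ha] at h1 h2
  rw [abs_le]
  constructor <;> linarith [(Nat.cast_le (α := ℤ)).2 h1, (Nat.cast_le (α := ℤ)).2 h2,
    Nat.cast_succ (R := ℤ) (numZeros p a b n j), Nat.cast_succ (R := ℤ) (numZeros p a b (n + 1) j)]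

theorem abs_numZeros_add_sub_le (p : ℕ) {a : ℕ → ℝ} (b : ℕ → ℝ) (ha : ∀ n, 1 ≤ n → 0 < a n)
    (n k : ℕ) (j : Fin p) : |(numZeros p a b (n + k) j : ℤ) - numZeros p a b n j| ≤ k := by
  induction k with
  | zero => simp
  | succ k ih =>
    have := abs_numZeros_succ_sub_le p b ha (n + k) j
    rw [← add_assoc]
    rw [abs_le] at *
    push_cast
    constructor <;> linarith [this.1, this.2, ih.1, ih.2]

/-! ### Transfer matrices -/

theorem extA_succ (p : ℕ) (a : ℕ → ℝ) (k : ℕ) : extA p a (k + 1) = a (k + 1) := by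
  simp [extA]

theorem extA_period (p : ℕ) (a : ℕ → ℝ) : extA p a p = extA p a 0 := by
  simp [extA]

theorem transferMatrix_succ_zero (p : ℕ) (a b : ℕ → ℝ) (n : ℕ) (i : Fin 2) :
    transferMatrix p a b (n + 1) 0 i =
      C (a (n + 1))⁻¹ * ((X - C (b (n + 1))) * transferMatrix p a b n 0 i -
        C (extA p a n) * transferMatrix p a b n 1 i) := by
  rw [transferMatrix, stepMatrix, Matrix.smul_mul, Matrix.smul_apply, Matrix.mul_apply,
    Fin.sum_univ_two, smul_eq_mul]
  simp only [Matrix.of_apply, Matrix.cons_val', Matrix.cons_val_zero, Matrix.cons_val_one]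
  ring

theorem transferMatrix_succ_one (p : ℕ) {a : ℕ → ℝ} (b : ℕ → ℝ) {n : ℕ} (ha : a (n + 1) ≠ 0)
    (i : Fin 2) : transferMatrix p a b (n + 1) 1 i = transferMatrix p a b n 0 i := by
  rw [transferMatrix, stepMatrix, Matrix.smul_mul, Matrix.smul_apply, Matrix.mul_apply,
    Fin.sum_univ_two, smul_eq_mul]
  simp only [Matrix.of_apply, Matrix.cons_val', Matrix.cons_val_zero, Matrix.cons_val_one,
    zero_mul, add_zero]
  rw [← mul_assoc, ← C_mul, inv_mul_cancel₀ ha, C_1, one_mul]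

theorem transferMatrix_zero_zero (p : ℕ) {a : ℕ → ℝ} (b : ℕ → ℝ) (ha : ∀ n, 1 ≤ n → 0 < a n)
    (n : ℕ) : transferMatrix p a b n 0 0 = orthonormalPoly a b n := by
  induction n using Nat.twoStepInduction with
  | zero => simp [transferMatrix, orthonormalPoly]
  | one =>
    rw [transferMatrix_succ_zero]
    simp [transferMatrix, orthonormalPoly]
  | more n h1 h2 =>
    rw [transferMatrix_succ_zero, transferMatrix_succ_one p b (ha (n + 1) (by omega)).ne', h1, h2,
      extA_succ, orthonormalPoly]

theorem transferMatrix_one_zero (p : ℕ) {a : ℕ → ℝ} (b : ℕ → ℝ) (ha : ∀ n, 1 ≤ n → 0 < a n)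
    (n : ℕ) : transferMatrix p a b (n + 1) 1 0 = orthonormalPoly a b n := by
  rw [transferMatrix_succ_one p b (ha (n + 1) (by omega)).ne', transferMatrix_zero_zero p b ha]

theorem extA_mul_det_transferMatrix (p : ℕ) {a : ℕ → ℝ} (b : ℕ → ℝ) (ha : ∀ n, 1 ≤ n → 0 < a n)
    (n : ℕ) : C (extA p a n) * (transferMatrix p a b n).det = C (extA p a 0) := by
  induction n with
  | zero => simp [transferMatrix]
  | succ n ih =>
    have h : a (n + 1) ≠ 0 := (ha (n + 1) (by omega)).ne'
    rw [← ih, Matrix.det_fin_two, Matrix.det_fin_two, transferMatrix_succ_zero,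
      transferMatrix_succ_zero, transferMatrix_succ_one p b h, transferMatrix_succ_one p b h,
      extA_succ]
    have hC : (C (a (n + 1)) * C (a (n + 1))⁻¹ : ℝ[X]) = 1 := by
      rw [← C_mul, mul_inv_cancel₀ h, C_1]
    linear_combination (C (extA p a n) * (transferMatrix p a b n 0 0 * transferMatrix p a b n 1 1 -
      transferMatrix p a b n 0 1 * transferMatrix p a b n 1 0)) * hC

theorem det_transferMatrix_period {p : ℕ} (hp : 1 ≤ p) {a : ℕ → ℝ} (b : ℕ → ℝ)
    (ha : ∀ n, 1 ≤ n → 0 < a n) : (transferMatrix p a b p).det = 1 := by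
  have h := extA_mul_det_transferMatrix p b ha p
  rw [extA_period] at h
  have h0 : (C (extA p a 0) : ℝ[X]) ≠ 0 := by
    simpa [extA] using (ha p hp).ne'
  exact mul_left_cancel₀ h0 (by rw [h, mul_one])

theorem stepMatrix_add_period {p : ℕ} {a b : ℕ → ℝ}
    (ha_per : ∀ n, 1 ≤ n → a (n + p) = a n) (hb_per : ∀ n, 1 ≤ n → b (n + p) = b n) (k : ℕ) :
    stepMatrix p a b (k + p) = stepMatrix p a b k := by
  have h1 : a (k + p + 1) = a (k + 1) := by
    rw [← ha_per (k + 1) (by omega), add_right_comm]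
  have h2 : b (k + p + 1) = b (k + 1) := by
    rw [← hb_per (k + 1) (by omega), add_right_comm]
  have h3 : extA p a (k + p) = extA p a k := by
    rcases k.eq_zero_or_pos with rfl | hk
    · simp [extA]
    · simp [extA, hk.ne', ha_per k hk]
  rw [stepMatrix, stepMatrix, h1, h2, h3]

theorem transferMatrix_mul_period {p : ℕ} {a b : ℕ → ℝ}
    (ha_per : ∀ n, 1 ≤ n → a (n + p) = a n) (hb_per : ∀ n, 1 ≤ n → b (n + p) = b n) (m : ℕ) :
    transferMatrix p a b (m * p) = transferMatrix p a b p ^ m := by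
  have h : ∀ n, transferMatrix p a b (n + p) = transferMatrix p a b n * transferMatrix p a b p := by
    intro n
    induction n with
    | zero => simp [transferMatrix]
    | succ n ih =>
      rw [add_right_comm, transferMatrix, transferMatrix, ih, stepMatrix_add_period ha_per hb_per,
        Matrix.mul_assoc]
  induction m with
  | zero => simp [transferMatrix]
  | succ m ih => rw [Nat.succ_mul, h, ih, pow_succ]

/-- Powers of a unimodular `2 × 2` matrix through Chebyshev polynomials of its trace, by
Cayley–Hamilton. -/
theorem pow_one_zero_eq_chebyshev {M : Matrix (Fin 2) (Fin 2) ℝ} (hM : M.det = 1) (m : ℕ) :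
    (M ^ m) 1 0 = (Chebyshev.U ℝ ((m : ℤ) - 1)).eval (M.trace / 2) * M 1 0 := by
  have hsq : M ^ 2 = M.trace • M - 1 := by
    have h := Matrix.det_fin_two M
    rw [hM] at h
    ext i j
    fin_cases i <;> fin_cases j <;>
      simp [pow_two, Matrix.mul_apply, Fin.sum_univ_two, Matrix.trace_fin_two]
    · linear_combination h
    · ring
    · ring
    · linear_combination h
  induction m using Nat.twoStepInduction with
  | zero => simp
  | one => simp
  | more m h1 h2 =>
    have h : M ^ (m + 2) = M.trace • M ^ (m + 1) - M ^ m := by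
      rw [pow_add, hsq, mul_sub, Matrix.mul_smul, mul_one, pow_succ]
    have hU := Chebyshev.U_add_two ℝ ((m : ℤ) - 1)
    rw [h, Matrix.sub_apply, Matrix.smul_apply, h1, h2,
      show (((m + 2 : ℕ) : ℤ) - 1) = (m : ℤ) - 1 + 2 by push_cast; ring, hU,
      show (((m + 1 : ℕ) : ℤ) - 1) = (m : ℤ) - 1 + 1 by push_cast; ring]
    simp only [eval_sub, eval_mul, eval_X, eval_ofNat, smul_eq_mul]
    ring

theorem orthonormalPoly_eval_period {p : ℕ} (hp : 1 ≤ p) {a b : ℕ → ℝ}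
    (ha : ∀ n, 1 ≤ n → 0 < a n) (ha_per : ∀ n, 1 ≤ n → a (n + p) = a n)
    (hb_per : ∀ n, 1 ≤ n → b (n + p) = b n) (m : ℕ) (x : ℝ) :
    (orthonormalPoly a b ((m + 1) * p - 1)).eval x =
      (Chebyshev.U ℝ m).eval ((discriminant p a b).eval x / 2) *
        (orthonormalPoly a b (p - 1)).eval x := by
  have h := pow_one_zero_eq_chebyshev (M := (evalRingHom x).mapMatrix (transferMatrix p a b p))
    (by rw [← RingHom.map_det, det_transferMatrix_period hp b ha, map_one]) (m + 1)
  rw [← map_pow, ← transferMatrix_mul_period ha_per hb_per] at h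
  have hn : (m + 1) * p - 1 + 1 = (m + 1) * p := Nat.sub_add_cancel (by nlinarith)
  have h1 := transferMatrix_one_zero p b ha ((m + 1) * p - 1)
  have h2 := transferMatrix_one_zero p b ha (p - 1)
  rw [hn] at h1
  rw [Nat.sub_add_cancel hp] at h2
  rw [RingHom.mapMatrix_apply, RingHom.mapMatrix_apply, Matrix.map_apply, Matrix.map_apply, h1, h2]
    at h
  rw [discriminant, Matrix.trace_fin_two]
  simpa [Matrix.trace_fin_two] using h

/-- At a zero of `p_{p-1}` the transfer matrix over a period is triangular with determinant `1`, so
its trace is outside `(-2, 2)`. -/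
theorem orthonormalPoly_eval_ne_zero {p : ℕ} (hp : 1 ≤ p) {a : ℕ → ℝ} (b : ℕ → ℝ)
    (ha : ∀ n, 1 ≤ n → 0 < a n) {x : ℝ} (hx : |(discriminant p a b).eval x| < 2) :
    (orthonormalPoly a b (p - 1)).eval x ≠ 0 := by
  intro h0
  have h2 := transferMatrix_one_zero p b ha (p - 1)
  rw [Nat.sub_add_cancel hp] at h2
  have hdet := congrArg (fun f => f.eval x) (det_transferMatrix_period hp b ha)
  simp only [Matrix.det_fin_two, h2, eval_sub, eval_mul, h0, mul_zero, sub_zero, eval_one] at hdet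
  rw [discriminant, Matrix.trace_fin_two, eval_add, abs_lt] at hx
  set s := (transferMatrix p a b p 0 0).eval x
  set t := (transferMatrix p a b p 1 1).eval x
  nlinarith [sq_nonneg (s - t), mul_pos (sub_pos.2 hx.1) (sub_pos.2 hx.2)]

theorem degree_transferMatrix (p : ℕ) {a : ℕ → ℝ} (b : ℕ → ℝ) (ha : ∀ n, 1 ≤ n → 0 < a n)
    (n : ℕ) : (transferMatrix p a b n 0 0).degree = n ∧ (transferMatrix p a b n 1 0).degree < n ∧
      (transferMatrix p a b n 0 1).degree < n ∧
      (transferMatrix p a b n 1 1).degree < ((n + 1 : ℕ) : WithBot ℕ) := by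
  induction n with
  | zero => simp [transferMatrix]
  | succ n ih =>
    obtain ⟨h1, h2, h3, h4⟩ := ih
    have h : a (n + 1) ≠ 0 := (ha (n + 1) (by omega)).ne'
    have hX : ∀ f : ℝ[X], ((X - C (b (n + 1))) * f).degree = 1 + f.degree := fun f => by
      rw [degree_mul, degree_X_sub_C]
    have hC : ∀ (c : ℝ) (f : ℝ[X]), (C c * f).degree ≤ f.degree := fun c f => by
      refine (degree_mul_le _ _).trans ?_
      simpa using add_le_add_left (degree_C_le (a := c)) f.degree
    have hlt : ((n : ℕ) : WithBot ℕ) < ((n + 1 : ℕ) : WithBot ℕ) := by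
      exact_mod_cast Nat.lt_succ_self n
    rw [transferMatrix_succ_one p b h, transferMatrix_succ_one p b h, transferMatrix_succ_zero,
      transferMatrix_succ_zero]
    refine ⟨?_, h1 ▸ hlt, ?_, h3.trans (hlt.trans (by exact_mod_cast Nat.lt_succ_self _))⟩
    · have e : ((X - C (b (n + 1))) * transferMatrix p a b n 0 0).degree =
          ((n + 1 : ℕ) : WithBot ℕ) := by
        rw [hX, h1]; push_cast; ring
      rw [degree_C_mul (inv_ne_zero h), degree_sub_eq_left_of_degree_lt, e]
      rw [e]
      exact (hC _ _).trans_lt (h2.trans hlt)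
    · refine (hC _ _).trans_lt ((degree_sub_le _ _).trans_lt (max_lt ?_ ((hC _ _).trans_lt h4)))
      rw [hX]
      rcases eq_or_ne (transferMatrix p a b n 0 1) 0 with h0 | h0
      · simp [h0]
      · rw [degree_eq_natDegree h0] at h3 ⊢
        norm_cast at h3 ⊢
        omega

theorem natDegree_discriminant {p : ℕ} (hp : 1 ≤ p) {a : ℕ → ℝ} (b : ℕ → ℝ)
    (ha : ∀ n, 1 ≤ n → 0 < a n) : (discriminant p a b).natDegree = p := by
  obtain ⟨h1, -⟩ := degree_transferMatrix p b ha p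
  refine natDegree_eq_of_degree_eq_some ?_
  rw [discriminant, Matrix.trace_fin_two, degree_add_eq_left_of_degree_lt, h1]
  obtain ⟨q, rfl⟩ : ∃ q, p = q + 1 := ⟨p - 1, by omega⟩
  rw [h1, transferMatrix_succ_one _ b (ha _ hp).ne']
  refine (degree_transferMatrix (q + 1) b ha q).2.2.1.trans ?_
  exact_mod_cast Nat.lt_succ_self q

/-! ### Real-rootedness of the discriminant -/

theorem exists_unit_eigenvalue {v : ℝ} (hv : v ∈ Set.Icc (-2 : ℝ) 2) :
    ∃ l : ℂ, l ^ 2 - v * l + 1 = 0 ∧ Complex.normSq l = 1 := by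
  have h : 0 ≤ 1 - (v / 2) ^ 2 := by nlinarith [hv.1, hv.2]
  obtain ⟨s, hs⟩ : ∃ s : ℝ, s ^ 2 = 1 - (v / 2) ^ 2 := ⟨_, Real.sq_sqrt h⟩
  refine ⟨⟨v / 2, s⟩, ?_, ?_⟩
  · apply Complex.ext
    · simp only [pow_two, Complex.add_re, Complex.sub_re, Complex.mul_re, Complex.ofReal_re,
        Complex.ofReal_im, Complex.one_re, Complex.zero_re]
      linear_combination -hs
    · simp [pow_two]
      ring
  · rw [Complex.normSq_mk]
    linear_combination hs

/-- A Floquet solution with a multiplier of modulus one exists only at real energies: over one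
period, `a_k Im (u_k * conj u_{k-1})` returns to its initial value, but it also grows by
`Im z * ∑ |u_k|²`. -/
theorem im_eq_zero_of_eval_discriminant {p : ℕ} (hp : 1 ≤ p) {a : ℕ → ℝ} (b : ℕ → ℝ)
    (ha : ∀ n, 1 ≤ n → 0 < a n) {v : ℝ} (hv : v ∈ Set.Icc (-2 : ℝ) 2) {z : ℂ}
    (hz : (discriminant p a b).eval₂ Complex.ofRealHom z = v) : z.im = 0 := by
  obtain ⟨l, hl, hl1⟩ := exists_unit_eigenvalue hv
  set φ : ℝ[X] →+* ℂ := eval₂RingHom Complex.ofRealHom z with hφ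
  have hφC : ∀ c, φ (C c) = c := fun c => by simp [hφ]
  have hφX : φ X = z := by simp [hφ]
  have hdet : (φ.mapMatrix (transferMatrix p a b p)).det = 1 := by
    rw [← RingHom.map_det, det_transferMatrix_period hp b ha, map_one]
  have htr : φ (transferMatrix p a b p 0 0) + φ (transferMatrix p a b p 1 1) = v := by
    rw [← map_add, ← Matrix.trace_fin_two, ← hz]
    rfl
  have hsing : (φ.mapMatrix (transferMatrix p a b p) - l • (1 : Matrix (Fin 2) (Fin 2) ℂ)).det = 0 := by
    rw [Matrix.det_fin_two] at hdet ⊢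
    simp only [RingHom.mapMatrix_apply, Matrix.map_apply] at hdet
    simp only [RingHom.mapMatrix_apply, Matrix.sub_apply, Matrix.map_apply, Matrix.smul_apply,
      Matrix.one_apply_eq, smul_eq_mul, mul_one, Matrix.one_apply_ne (zero_ne_one (α := Fin 2)),
      Matrix.one_apply_ne (one_ne_zero (α := Fin 2)), mul_zero, sub_zero]
    linear_combination hdet - l * htr + hl
  obtain ⟨w, hw0, hw⟩ := Matrix.exists_mulVec_eq_zero_iff.2 hsing
  rw [Matrix.sub_mulVec, Matrix.smul_mulVec, Matrix.one_mulVec, sub_eq_zero] at hw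
  -- The Floquet solution: `u k` is the pair `(u_k, u_{k-1})`.
  set u : ℕ → Fin 2 → ℂ := fun k i =>
    φ (transferMatrix p a b k i 0) * w 0 + φ (transferMatrix p a b k i 1) * w 1 with hu
  have hup : ∀ i, u p i = l * w i := fun i => by
    have := congrFun hw i
    simpa [Matrix.mulVec, dotProduct, Fin.sum_univ_two, hu] using this
  have hu0 : ∀ i, u 0 i = w i := fun i => by
    fin_cases i <;> simp [hu, transferMatrix]
  have hstep1 : ∀ k, u (k + 1) 1 = u k 0 := fun k => by
    have h := (ha (k + 1) (by omega)).ne'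
    simp only [hu, transferMatrix_succ_one p b h]
  have hstep0 : ∀ k, (a (k + 1) : ℂ) * u (k + 1) 0 =
      (z - b (k + 1)) * u k 0 - extA p a k * u k 1 := fun k => by
    have h : (a (k + 1) : ℂ) ≠ 0 := by exact_mod_cast (ha (k + 1) (by omega)).ne'
    simp only [hu, transferMatrix_succ_zero, map_mul, map_sub, hφC, hφX, Complex.ofReal_inv]
    field_simp
    ring
  have hsum : ∀ n, extA p a n * ((u n 0).im * (u n 1).re - (u n 0).re * (u n 1).im) =
      extA p a 0 * ((u 0 0).im * (u 0 1).re - (u 0 0).re * (u 0 1).im) +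
        z.im * ∑ k ∈ Finset.range n, Complex.normSq (u k 0) := by
    intro n
    induction n with
    | zero => simp
    | succ n ih =>
      have hre := congrArg Complex.re (hstep0 n)
      have him := congrArg Complex.im (hstep0 n)
      simp only [Complex.mul_re, Complex.mul_im, Complex.sub_re, Complex.sub_im,
        Complex.ofReal_re, Complex.ofReal_im, zero_mul, sub_zero, add_zero] at hre him
      rw [hstep1, extA_succ, Finset.sum_range_succ, Complex.normSq_apply]
      linear_combination ih + him * (u n 0).re - hre * (u n 0).im
  have hper := hsum p
  rw [extA_period, hup, hup, hu0, hu0] at hper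
  have hzero : z.im * ∑ k ∈ Finset.range p, Complex.normSq (u k 0) = 0 := by
    rw [Complex.normSq_apply] at hl1
    simp only [Complex.mul_re, Complex.mul_im] at hper
    linear_combination -hper +
      extA p a 0 * ((w 0).im * (w 1).re - (w 0).re * (w 1).im) * hl1
  refine (mul_eq_zero.1 hzero).resolve_right fun hs => hw0 ?_
  have hall := (Finset.sum_eq_zero_iff_of_nonneg fun k _ => Complex.normSq_nonneg (u k 0)).1 hs
  have hl0 : l ≠ 0 := fun h => by simp [h] at hl1
  have e0 : w 0 = 0 := by
    rw [← hu0]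
    exact Complex.normSq_eq_zero.1 (hall 0 (Finset.mem_range.2 hp))
  have e1 : l * w 1 = 0 := by
    rw [← hup, ← Nat.sub_add_cancel hp, hstep1]
    exact Complex.normSq_eq_zero.1 (hall (p - 1) (Finset.mem_range.2 (by omega)))
  funext i
  fin_cases i
  · exact e0
  · exact (mul_eq_zero.1 e1).resolve_left hl0

theorem splits_discriminant_sub_C {p : ℕ} (hp : 1 ≤ p) {a : ℕ → ℝ} (b : ℕ → ℝ)
    (ha : ∀ n, 1 ≤ n → 0 < a n) {v : ℝ} (hv : v ∈ Set.Icc (-2 : ℝ) 2) :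
    (discriminant p a b - C v).Splits := by
  refine Splits.of_splits_map Complex.ofRealHom (IsAlgClosed.splits _) fun z hz => ?_
  have h : (discriminant p a b).eval₂ Complex.ofRealHom z = v := by
    have := isRoot_of_mem_roots hz
    rw [IsRoot, eval_map, eval₂_sub, eval₂_C, sub_eq_zero] at this
    exact this
  exact ⟨z.re, Complex.ext (by simp) (by simp [im_eq_zero_of_eval_discriminant hp b ha hv h])⟩

theorem eval_derivative_discriminant_ne_zero {p : ℕ} (hp : 1 ≤ p) {a : ℕ → ℝ} (b : ℕ → ℝ)
    (ha : ∀ n, 1 ≤ n → 0 < a n) {x : ℝ} (hx : |(discriminant p a b).eval x| < 2) :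
    (derivative (discriminant p a b)).eval x ≠ 0 :=
  eval_derivative_ne_zero_of_splits (by rw [natDegree_discriminant hp b ha]; omega)
    (fun _ hv => splits_discriminant_sub_C hp b ha hv) hx

/-! ### Bands -/

/-- The sign of `∏ (c - r)` is the parity of the number of factors with `c < r`. -/
theorem prod_sub_pos_and_neg (s : Multiset ℝ) (c : ℝ) (hc : c ∉ s) :
    (Even (s.countP (c < ·)) → 0 < (s.map fun r => c - r).prod) ∧
      (Odd (s.countP (c < ·)) → (s.map fun r => c - r).prod < 0) := by
  induction s using Multiset.induction with
  | empty => simp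
  | cons r t ih =>
    rw [Multiset.mem_cons, not_or] at hc
    obtain ⟨h1, h2⟩ := ih hc.2
    rw [Multiset.map_cons, Multiset.prod_cons, Multiset.countP_cons]
    rcases lt_or_gt_of_ne hc.1 with h | h
    · rw [if_pos h, Nat.even_add_one, Nat.odd_add_one, Nat.not_even_iff_odd, Nat.not_odd_iff_even]
      exact ⟨fun ho => mul_pos_of_neg_of_neg (sub_neg.2 h) (h2 ho),
        fun he => mul_neg_of_neg_of_pos (sub_neg.2 h) (h1 he)⟩
    · rw [if_neg h.not_gt, add_zero]
      exact ⟨fun he => mul_pos (sub_pos.2 h) (h1 he),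
        fun ho => mul_neg_of_pos_of_neg (sub_pos.2 h) (h2 ho)⟩

/-- In a sorted list, the entries below `c` are those with index less than their number. -/
theorem getElem_lt_iff_of_pairwise {l : List ℝ} (hl : l.Pairwise (· ≤ ·)) (c : ℝ) (i : ℕ)
    (hi : i < l.length) : l[i] < c ↔ i < l.countP (· < c) := by
  induction l generalizing i with
  | nil => simp at hi
  | cons r t ih =>
    rw [List.pairwise_cons] at hl
    rw [List.countP_cons]
    by_cases h : r < c
    · cases i with
      | zero => simp [h]
      | succ i => simpa [h] using ih hl.2 i (by simpa using hi)
    · have h0 : t.countP (· < c) = 0 := by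
        rw [List.countP_eq_zero]
        intro x hx
        simpa using (not_lt.1 h).trans (hl.1 x hx)
      have h1 : ¬ (r :: t)[i] < c := by
        rw [not_lt]
        rcases List.mem_cons.1 (List.getElem_mem hi) with h' | h'
        · rw [h']
          exact not_lt.1 h
        · exact (not_lt.1 h).trans (hl.1 _ h')
      simp [h1, h0, h]

section Bands

variable {p : ℕ} {a : ℕ → ℝ} (b : ℕ → ℝ)

theorem mem_bandEdges (hp : 1 ≤ p) (ha : ∀ n, 1 ≤ n → 0 < a n) (x : ℝ) :
    x ∈ bandEdges p a b ↔ |(discriminant p a b).eval x| = 2 := by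
  have hne : ∀ c : ℝ, discriminant p a b - C c ≠ 0 := fun c h => by
    have := natDegree_sub_C (p := discriminant p a b) (a := c)
    rw [h, natDegree_discriminant hp b ha, natDegree_zero] at this
    omega
  have hne' : discriminant p a b + C 2 ≠ 0 := by
    simpa using hne (-2)
  rw [bandEdges, Multiset.mem_sort, Multiset.mem_add, mem_roots (hne 2), mem_roots hne', IsRoot,
    IsRoot, eval_sub, eval_add, eval_C, sub_eq_zero, add_eq_zero_iff_eq_neg,
    abs_eq (zero_le_two)]

theorem length_bandEdges (hp : 1 ≤ p) (ha : ∀ n, 1 ≤ n → 0 < a n) :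
    (bandEdges p a b).length = 2 * p := by
  have h1 := splits_discriminant_sub_C hp b ha (v := 2) (by norm_num)
  have h2 := splits_discriminant_sub_C hp b ha (v := -2) (by norm_num)
  have d1 := h1.natDegree_eq_card_roots
  have d2 := h2.natDegree_eq_card_roots
  rw [natDegree_sub_C, natDegree_discriminant hp b ha] at d1 d2
  rw [C_neg, sub_neg_eq_add] at d2
  rw [bandEdges, Multiset.length_sort, Multiset.card_add, ← d1, ← d2, two_mul]

theorem eval_discriminant_sq_sub (hp : 1 ≤ p) (ha : ∀ n, 1 ≤ n → 0 < a n) (x : ℝ) :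
    (discriminant p a b).eval x ^ 2 - 4 = (discriminant p a b).leadingCoeff ^ 2 *
      (Multiset.map (fun r => x - r) (bandEdges p a b : Multiset ℝ)).prod := by
  have hd : 0 < (discriminant p a b).degree :=
    natDegree_pos_iff_degree_pos.1 (by rw [natDegree_discriminant hp b ha]; omega)
  have h1 := splits_discriminant_sub_C hp b ha (v := 2) (by norm_num)
  have h2 := splits_discriminant_sub_C hp b ha (v := -2) (by norm_num)
  have e1 := h1.eval_eq_prod_roots x
  have e2 := h2.eval_eq_prod_roots x
  rw [leadingCoeff_sub_of_degree_lt (degree_C_le.trans_lt hd)] at e1 e2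
  rw [C_neg, sub_neg_eq_add] at e2
  rw [bandEdges, Multiset.sort_eq, Multiset.map_add, Multiset.prod_add]
  simp only [eval_sub, eval_add, eval_C] at e1 e2
  linear_combination e1 * ((discriminant p a b).eval x + 2) +
    (discriminant p a b).leadingCoeff *
      ((discriminant p a b - C 2).roots.map fun r => x - r).prod * e2

/-- A point where `|Δ| < 2` has an odd number of band edges to its left: the sign of `Δ² - 4` there
gives the parity of the number of edges to the right, and there are `2p` edges in total. -/
theorem odd_countP_bandEdges (hp : 1 ≤ p) (ha : ∀ n, 1 ≤ n → 0 < a n) {c : ℝ}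
    (hc : |(discriminant p a b).eval c| < 2) : Odd ((bandEdges p a b).countP (· < c)) := by
  have hmem : c ∉ bandEdges p a b := fun h => hc.ne ((mem_bandEdges b hp ha c).1 h)
  have hQ := eval_discriminant_sq_sub b hp ha c
  have hneg : (discriminant p a b).eval c ^ 2 - 4 < 0 := by
    rw [abs_lt] at hc
    nlinarith
  have hodd : Odd ((bandEdges p a b).countP (c < ·)) := by
    rw [← Nat.not_even_iff_odd]
    intro he
    have := (prod_sub_pos_and_neg (bandEdges p a b) c (by simpa using hmem)).1
      (by simpa using he)
    have := mul_nonneg (sq_nonneg (discriminant p a b).leadingCoeff) this.le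
    linarith
  have htot := List.length_eq_countP_add_countP (fun r => decide (r < c)) (l := bandEdges p a b)
  have hcongr : (bandEdges p a b).countP (fun r => decide ¬ (decide (r < c) = true)) =
      (bandEdges p a b).countP (c < ·) := by
    refine List.countP_congr fun r hr => ?_
    have : r ≠ c := fun h => hmem (h ▸ hr)
    simp only [decide_eq_true_eq, not_lt]
    exact ⟨fun h => lt_of_le_of_ne h this.symm, le_of_lt⟩
  rw [hcongr, length_bandEdges b hp ha] at htot
  obtain ⟨k, hk⟩ := hodd
  exact ⟨p - k - 1, by omega⟩

/-- Between two zeros of `Δ` there is a critical point of `Δ`, hence a point with `|Δ| ≥ 2`. -/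
theorem exists_bandEdge_between (hp : 1 ≤ p) (ha : ∀ n, 1 ≤ n → 0 < a n) {x y : ℝ}
    (hxy : x < y) (hx : (discriminant p a b).eval x = 0) (hy : (discriminant p a b).eval y = 0) :
    ∃ r ∈ bandEdges p a b, x < r ∧ r < y := by
  obtain ⟨z, hz, h⟩ := exists_hasDerivAt_eq_zero hxy
    (discriminant p a b).continuous.continuousOn (hx.trans hy.symm)
    (fun t _ => (discriminant p a b).hasDerivAt t)
  have hz2 : 2 ≤ |(discriminant p a b).eval z| := by
    by_contra! hlt
    exact eval_derivative_discriminant_ne_zero hp b ha hlt h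
  obtain ⟨r, hr, h2⟩ := intermediate_value_Icc hz.1.le
    (f := fun t => |(discriminant p a b).eval t|)
    (discriminant p a b).continuous.abs.continuousOn (show (2 : ℝ) ∈ _ by simp [hx, hz2])
  refine ⟨r, (mem_bandEdges b hp ha r).2 h2, lt_of_le_of_ne hr.1 ?_, hr.2.trans_lt hz.2⟩
  rintro rfl
  simp [hx] at h2

/-- For each `j < p`, some zero of `Δ` has exactly `2j + 1` band edges to its left. The `p` zeros
of `Δ` are simple and separated by edges, so their edge counts are distinct odd numbers below
`2p`, and every such number occurs. -/
theorem exists_zero_countP_bandEdges (hp : 1 ≤ p) (ha : ∀ n, 1 ≤ n → 0 < a n) {j : ℕ}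
    (hj : j < p) : ∃ c : ℝ, (discriminant p a b).eval c = 0 ∧
      (bandEdges p a b).countP (· < c) = 2 * j + 1 := by
  set D := discriminant p a b with hD
  have hD0 : D ≠ 0 := fun h => by
    have := natDegree_discriminant hp b ha
    rw [← hD, h, natDegree_zero] at this
    omega
  have hroot : ∀ c ∈ D.roots.toFinset, D.eval c = 0 := fun c hc => by
    simpa [hD0] using hc
  have hsep : D.roots.Nodup := by
    rw [Multiset.nodup_iff_count_le_one]
    intro c
    rw [count_roots]
    by_contra! h
    obtain ⟨h0, h1⟩ := (one_lt_rootMultiplicity_iff_isRoot hD0).1 h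
    exact eval_derivative_discriminant_ne_zero hp b ha (x := c)
      (by rw [← hD, h0.eq_zero]; norm_num) h1
  have hcard : D.roots.toFinset.card = p := by
    have h := splits_discriminant_sub_C hp b ha (v := 0) (by norm_num)
    rw [C_0, sub_zero] at h
    rw [Multiset.toFinset_card_of_nodup hsep, ← h.natDegree_eq_card_roots,
      natDegree_discriminant hp b ha]
  have hodd : ∀ c ∈ D.roots.toFinset, Odd ((bandEdges p a b).countP (· < c)) := fun c hc =>
    odd_countP_bandEdges b hp ha (by rw [← hD, hroot c hc]; norm_num)
  have hmono : ∀ c ∈ D.roots.toFinset, ∀ d ∈ D.roots.toFinset, c < d →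
      (bandEdges p a b).countP (· < c) < (bandEdges p a b).countP (· < d) := by
    intro c hc d hd hcd
    obtain ⟨r, hr, h1, h2⟩ := exists_bandEdge_between b hp ha hcd (hroot c hc) (hroot d hd)
    have hsub : ((bandEdges p a b).filter (· < c)).countP (· < d) =
        (bandEdges p a b).countP (· < c) := by
      rw [List.countP_filter]
      refine List.countP_congr fun x _ => ?_
      simp only [Bool.and_eq_true, decide_eq_true_eq]
      exact ⟨fun h => h.2, fun h => ⟨h.trans hcd, h⟩⟩
    have hsplit := List.countP_eq_countP_filter_add (bandEdges p a b)
      (fun x => decide (x < d)) (fun x => decide (x < c))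
    have hpos : 0 < ((bandEdges p a b).filter (fun x => !decide (x < c))).countP (· < d) :=
      List.countP_pos_iff.2 ⟨r, by simp [hr, h1.le], by simpa using h2⟩
    rw [hsub] at hsplit
    omega
  obtain ⟨c, hc, h⟩ := Finset.surj_on_of_inj_on_of_card_le (s := D.roots.toFinset)
    (t := Finset.range p) (fun c _ => (bandEdges p a b).countP (· < c) / 2)
    (fun c hc => by
      have h1 := List.countP_le_length (p := fun r => decide (r < c)) (l := bandEdges p a b)
      rw [length_bandEdges b hp ha] at h1
      obtain ⟨k, hk⟩ := hodd c hc
      rw [Finset.mem_range]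
      omega)
    (fun c d hc hd h => by
      obtain ⟨k, hk⟩ := hodd c hc
      obtain ⟨l, hl⟩ := hodd d hd
      by_contra hne
      rcases lt_or_gt_of_ne hne with hlt | hlt
      · have := hmono c hc d hd hlt
        omega
      · have := hmono d hd c hc hlt
        omega)
    (by rw [hcard, Finset.card_range]) j (Finset.mem_range.2 hj)
  obtain ⟨k, hk⟩ := hodd c hc
  exact ⟨c, hroot c hc, by omega⟩

/-- The `j`-th band is a nonempty interval, bounded by edges, on which `|Δ| < 2`: the two edges
surround a zero of `Δ`, and no edge lies strictly between them. -/
theorem abs_discriminant_band (hp : 1 ≤ p) (ha : ∀ n, 1 ≤ n → 0 < a n) (j : Fin p) :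
    |(discriminant p a b).eval (bandLeft p a b j)| = 2 ∧
      |(discriminant p a b).eval (bandRight p a b j)| = 2 ∧
      bandLeft p a b j < bandRight p a b j ∧
      ∀ x ∈ Set.Ioo (bandLeft p a b j) (bandRight p a b j),
        |(discriminant p a b).eval x| < 2 := by
  obtain ⟨c, hc, hk⟩ := exists_zero_countP_bandEdges b hp ha j.2
  have hlen := length_bandEdges b hp ha
  have hj := j.2
  have hsort : (bandEdges p a b).Pairwise (· ≤ ·) := Multiset.pairwise_sort _ _
  have hl : 2 * (j : ℕ) < (bandEdges p a b).length := by omega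
  have hr : 2 * (j : ℕ) + 1 < (bandEdges p a b).length := by omega
  have eL : bandLeft p a b j = (bandEdges p a b)[2 * (j : ℕ)] := by
    rw [bandLeft, List.getD_eq_getElem _ _ hl]
  have eR : bandRight p a b j = (bandEdges p a b)[2 * (j : ℕ) + 1] := by
    rw [bandRight, List.getD_eq_getElem _ _ hr]
  have hle : ∀ i k (hi : i < (bandEdges p a b).length) (hk : k < (bandEdges p a b).length),
      i ≤ k → (bandEdges p a b)[i] ≤ (bandEdges p a b)[k] := by
    intro i k hi hk hik
    rcases hik.eq_or_lt with rfl | h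
    · exact le_rfl
    · exact List.pairwise_iff_getElem.1 hsort i k hi hk h
  have hLmem : bandLeft p a b j ∈ bandEdges p a b := eL ▸ List.getElem_mem hl
  have hRmem : bandRight p a b j ∈ bandEdges p a b := eR ▸ List.getElem_mem hr
  have hLc : bandLeft p a b j < c := by
    rw [eL, getElem_lt_iff_of_pairwise hsort, hk]
    omega
  have hcR : c < bandRight p a b j := by
    refine lt_of_le_of_ne ?_ fun h => ?_
    · rw [eR, ← not_lt, getElem_lt_iff_of_pairwise hsort, hk]
      omega
    · rw [← h, mem_bandEdges b hp ha, hc] at hRmem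
      norm_num at hRmem
  have hno : ∀ x ∈ Set.Ioo (bandLeft p a b j) (bandRight p a b j), x ∉ bandEdges p a b := by
    intro x hx hmem
    obtain ⟨i, hi, rfl⟩ := List.getElem_of_mem hmem
    rcases Nat.lt_or_ge (2 * (j : ℕ)) i with h | h
    · refine hx.2.not_ge ?_
      rw [eR]
      exact hle _ _ hr hi (Nat.succ_le_of_lt h)
    · refine hx.1.not_ge ?_
      rw [eL]
      exact hle _ _ hi hl h
  refine ⟨(mem_bandEdges b hp ha _).1 hLmem, (mem_bandEdges b hp ha _).1 hRmem, hLc.trans hcR,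
    fun x hx => ?_⟩
  by_contra! h2
  have hu : Set.uIcc c x ⊆ Set.Ioo (bandLeft p a b j) (bandRight p a b j) :=
    Set.OrdConnected.uIcc_subset Set.ordConnected_Ioo ⟨hLc, hcR⟩ hx
  obtain ⟨y, hy, h⟩ := intermediate_value_uIcc (a := c) (b := x)
    (f := fun t => |(discriminant p a b).eval t|)
    (discriminant p a b).continuous.abs.continuousOn
    (show (2 : ℝ) ∈ _ from Set.mem_uIcc.2 (Or.inl ⟨by simp [hc], h2⟩))
  exact hno y (hu hy) ((mem_bandEdges b hp ha y).2 h)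

/-- The discriminant maps each open band bijectively onto `(-2, 2)`. -/
theorem bijOn_discriminant_band (hp : 1 ≤ p) (ha : ∀ n, 1 ≤ n → 0 < a n) (j : Fin p) :
    Set.BijOn (fun x => (discriminant p a b).eval x)
      (Set.Ioo (bandLeft p a b j) (bandRight p a b j)) (Set.Ioo (-2) 2) := by
  obtain ⟨hL, hR, hlt, hin⟩ := abs_discriminant_band b hp ha j
  set D := discriminant p a b
  have hinj : Set.InjOn (fun x => D.eval x)
      (Set.Icc (bandLeft p a b j) (bandRight p a b j)) := by
    have key : ∀ x ∈ Set.Icc (bandLeft p a b j) (bandRight p a b j),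
        ∀ y ∈ Set.Icc (bandLeft p a b j) (bandRight p a b j), x < y → D.eval x ≠ D.eval y := by
      intro x hx y hy hxy h
      obtain ⟨z, hz, h0⟩ := exists_hasDerivAt_eq_zero hxy D.continuous.continuousOn h
        (fun t _ => D.hasDerivAt t)
      exact eval_derivative_discriminant_ne_zero hp b ha
        (hin z ⟨hx.1.trans_lt hz.1, hz.2.trans_le hy.2⟩) h0
    intro x hx y hy h
    by_contra hne
    rcases lt_or_gt_of_ne hne with h' | h'
    · exact key x hx y hy h' h
    · exact key y hy x hx h' h.symm
  refine ⟨fun x hx => abs_lt.1 (hin x hx), hinj.mono Set.Ioo_subset_Icc_self, ?_⟩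
  have hne : D.eval (bandLeft p a b j) ≠ D.eval (bandRight p a b j) := fun h =>
    hlt.ne (hinj (Set.left_mem_Icc.2 hlt.le) (Set.right_mem_Icc.2 hlt.le) h)
  rw [abs_eq zero_le_two] at hL hR
  rcases hL with hL | hL <;> rcases hR with hR | hR
  · exact absurd (hL.trans hR.symm) hne
  · have := intermediate_value_Ioo' hlt.le D.continuous.continuousOn
    rwa [hL, hR] at this
  · have := intermediate_value_Ioo hlt.le D.continuous.continuousOn
    rwa [hL, hR] at this
  · exact absurd (hL.trans hR.symm) hne

end Bands

/-! ### Counting zeros -/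

theorem ncard_isRoot_chebyshev_U (m : ℕ) :
    {v : ℝ | v ∈ Set.Ioo (-2 : ℝ) 2 ∧ (Chebyshev.U ℝ m).eval (v / 2) = 0}.ncard = m := by
  have hU : Chebyshev.U ℝ m ≠ 0 := fun h => by
    have := Chebyshev.degree_U_natCast ℝ m
    simp [h] at this
  have hroots := Chebyshev.roots_U_real m
  have hcard : (Chebyshev.U ℝ m).roots.toFinset.card = m := by
    rw [hroots, Finset.val_toFinset, Finset.card_image_of_injOn, Finset.card_range]
    exact (Finset.range m).nodup_map_iff_injOn.mp (Chebyshev.roots_U_real_nodup m)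
  have hset : {v : ℝ | v ∈ Set.Ioo (-2 : ℝ) 2 ∧ (Chebyshev.U ℝ m).eval (v / 2) = 0} =
      (fun y : ℝ => 2 * y) '' ((Chebyshev.U ℝ m).roots.toFinset : Set ℝ) := by
    ext v
    simp only [Set.mem_ofPred_eq, Set.mem_image, Finset.mem_coe, Multiset.mem_toFinset]
    constructor
    · rintro ⟨-, h⟩
      exact ⟨v / 2, (mem_roots hU).2 h, by ring⟩
    · rintro ⟨y, hy, rfl⟩
      refine ⟨?_, by simpa using (mem_roots hU).1 hy⟩
      rw [hroots, Finset.mem_val, Finset.mem_image] at hy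
      obtain ⟨k, hk, rfl⟩ := hy
      have hk' : (k : ℝ) + 1 < m + 1 := by
        exact_mod_cast Nat.succ_lt_succ (Finset.mem_range.1 hk)
      have hm : (0 : ℝ) < m + 1 := by positivity
      have h0 : 0 < ((k : ℝ) + 1) * Real.pi / (m + 1) := by positivity
      have hpi : ((k : ℝ) + 1) * Real.pi / (m + 1) < Real.pi := by
        rw [div_lt_iff₀ hm, mul_comm]
        exact mul_lt_mul_of_pos_left hk' Real.pi_pos
      have h1 := Real.cos_lt_cos_of_nonneg_of_le_pi le_rfl hpi.le h0
      have h2 := Real.cos_lt_cos_of_nonneg_of_le_pi h0.le le_rfl hpi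
      rw [Real.cos_zero] at h1
      rw [Real.cos_pi] at h2
      exact ⟨by linarith, by linarith⟩
  rw [hset, Set.ncard_image_of_injective _ (mul_right_injective₀ two_ne_zero),
    Set.ncard_coe_finset, hcard]

/-- The polynomial `P_{(m+1)p-1}` has exactly `m` zeros in each band. -/
theorem numZeros_period {p : ℕ} (hp : 1 ≤ p) {a b : ℕ → ℝ}
    (ha : ∀ n, 1 ≤ n → 0 < a n) (ha_per : ∀ n, 1 ≤ n → a (n + p) = a n)
    (hb_per : ∀ n, 1 ≤ n → b (n + p) = b n) (m : ℕ) (j : Fin p) :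
    numZeros p a b ((m + 1) * p - 1) j = m := by
  obtain ⟨hmaps, hinj, hsurj⟩ := bijOn_discriminant_band b hp ha j
  rw [numZeros_eq p b ha]
  conv_rhs => rw [← ncard_isRoot_chebyshev_U m]
  refine Set.ncard_congr (fun x _ => (discriminant p a b).eval x) ?_ ?_ ?_
  · rintro x ⟨hx, h⟩
    rw [IsRoot, orthonormalPoly_eval_period hp ha ha_per hb_per] at h
    exact ⟨hmaps hx, (mul_eq_zero.1 h).resolve_right
      (orthonormalPoly_eval_ne_zero hp b ha (abs_lt.2 (hmaps hx)))⟩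
  · exact fun x y hx hy h => hinj hx.1 hy.1 h
  · rintro v ⟨hv, h⟩
    obtain ⟨x, hx, rfl⟩ := hsurj hv
    refine ⟨x, ⟨hx, ?_⟩, rfl⟩
    rw [IsRoot, orthonormalPoly_eval_period hp ha ha_per hb_per]
    exact mul_eq_zero_of_left h _

/-- For `n = mp + r` with `r ≥ 0`, interlacing compares `N` with its value `m` at degree
`(m+1)p - 1` and, on the other side, with its value `m - 1` at degree `mp - 1`; for `m = 0` the
latter comparison is the trivial bound by the degree. -/
theorem abs_numZeros_sub_le {p : ℕ} (hp : 1 ≤ p) {a b : ℕ → ℝ}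
    (ha : ∀ n, 1 ≤ n → 0 < a n) (ha_per : ∀ n, 1 ≤ n → a (n + p) = a n)
    (hb_per : ∀ n, 1 ≤ n → b (n + p) = b n) (m r : ℕ) (hr : r < p) (j : Fin p) :
    |(numZeros p a b (m * p + r) j : ℤ) - ((m : ℤ) - 1)| ≤ r + 1 ∧
      |(numZeros p a b (m * p + r) j : ℤ) - m| ≤ p - 1 - r := by
  constructor
  · cases m with
    | zero =>
      have := numZeros_le p b ha (0 * p + r) j
      rw [abs_le]
      omega
    | succ m =>
      have h := abs_numZeros_add_sub_le p b ha ((m + 1) * p - 1) (r + 1) j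
      have hpos : 1 ≤ (m + 1) * p := Nat.mul_pos m.succ_pos hp
      rw [numZeros_period hp ha ha_per hb_per,
        show (m + 1) * p - 1 + (r + 1) = (m + 1) * p + r by omega] at h
      simpa using h
  · have h := abs_numZeros_add_sub_le p b ha (m * p + r) (p - 1 - r) j
    rw [show m * p + r + (p - 1 - r) = (m + 1) * p - 1 by rw [Nat.succ_mul]; omega,
      numZeros_period hp ha ha_per hb_per, abs_sub_comm] at h
    rwa [show ((p - 1 - r : ℕ) : ℤ) = (p : ℤ) - 1 - r by omega] at h

end PeriodicJacobi

theorem theorem2p3 (p : ℕ) (hp : 1 ≤ p) (a b : ℕ → ℝ)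
    (ha_pos : ∀ n, 1 ≤ n → 0 < a n)
    (ha_per : ∀ n, 1 ≤ n → a (n + p) = a n)
    (hb_per : ∀ n, 1 ≤ n → b (n + p) = b n)
    (j : Fin p) :
    (∀ (m n : ℕ) (r : ℤ), -1 ≤ r → r ≤ (p : ℤ) - 1 → (n : ℤ) = (m : ℤ) * (p : ℤ) + r →
      |(PeriodicJacobi.numZeros p a b n j : ℤ) - ((m : ℤ) - 1)| ≤ min (r + 1) ((p : ℤ) - r)) ∧
    (∀ n : ℕ,
      |(PeriodicJacobi.numZeros p a b n j : ℝ) - (n : ℝ) / (p : ℝ)| ≤ 1 + (p : ℝ) / 2) := by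
  have key := fun m r hr =>
    PeriodicJacobi.abs_numZeros_sub_le hp ha_pos ha_per hb_per m r hr j
  constructor
  · intro m n r hr1 hr2 hn
    rcases eq_or_lt_of_le hr1 with rfl | hr0
    · cases m with
      | zero => simp at hn
      | succ m =>
        have hpos : 1 ≤ (m + 1) * p := Nat.mul_pos m.succ_pos hp
        have hn' : n = (m + 1) * p - 1 := by
          zify [hpos]
          push_cast at hn
          linarith
        rw [hn', PeriodicJacobi.numZeros_period hp ha_pos ha_per hb_per]
        simp
        omega
    · lift r to ℕ using by omega
      have hn' : n = m * p + r := by exact_mod_cast hn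
      obtain ⟨h1, h2⟩ := key m r (by omega)
      rw [← hn'] at h1 h2
      rw [abs_le] at *
      rw [le_min_iff] at *
      omega
  · intro n
    obtain ⟨h1, h2⟩ := key (n / p) (n % p) (Nat.mod_lt n hp)
    have hr := Nat.mod_lt n hp
    have hn : (n : ℝ) = (n / p : ℕ) * p + (n % p : ℕ) := by
      exact_mod_cast (Nat.div_add_mod' n p).symm
    rw [Nat.div_add_mod'] at h1 h2
    generalize n / p = m at *
    generalize n % p = r at *
    generalize PeriodicJacobi.numZeros p a b n j = N at *
    have hp0 : (0 : ℝ) < p := by exact_mod_cast hp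
    have hp1 : (1 : ℝ) ≤ p := by exact_mod_cast hp
    have hr' : (r : ℝ) + 1 ≤ p := by exact_mod_cast hr
    have hr0 : (0 : ℝ) ≤ r := r.cast_nonneg
    have h1' : |(N : ℝ) - ((m : ℝ) - 1)| ≤ r + 1 := by exact_mod_cast h1
    have h2' : |(N : ℝ) - m| ≤ p - 1 - r := by exact_mod_cast h2
    have hq : (n : ℝ) / p = m + r / p := by
      rw [hn]
      field_simp
    have hrp : (r : ℝ) / p * p = r := div_mul_cancel₀ _ hp0.ne'
    have hrp0 : 0 ≤ (r : ℝ) / p := by positivity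
    have hrp1 : (r : ℝ) / p ≤ 1 := by rw [div_le_one hp0]; linarith
    rw [hq]
    rw [abs_le] at *
    constructor
    -- The lower bounds `m - r - 2` and `m + 1 + r - p` for `N` are both needed: for `r` near `p` the
    -- bound in the first part of the theorem is too weak, since there `N` is compared with `m - 1`.
    · by_contra! hlt
      nlinarith [mul_nonneg hrp0 hp0.le]
    · linarith
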